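/- Let $n$ and $k$ be integers with $1\le k\le n-1$, and consider the Hopfield network $$\dot x_i=-\frac{x_i}{r_i}+\sum_{j=1}^n w_{ij}\,\phi_j(x_j)+u_i,\qquad i=1,\dots,n,$$ with $r_i>0$, $w_{ij},u_i\in\mathbb R$ and $C^1$ functions $\phi_i:\mathbb R\to\mathbb R$ satisfying $0\le m_i\le|\phi_i'(z)|\le M_i$ for all $z\in\mathbb R$ and all $i$. Suppose that there are $\eta>0$ and $d_1,\dots,d_n>0$ such that, for all $i\in\{1,\dots,n\}$, $$-(n-k-1)\bigl(-r_i^{-1}-m_i|w_{ii}|\bigr)+\sum_{j\ne i}\Bigl(-r_j^{-1}+M_j|w_{jj}|+(n-k)\frac{d_j}{d_i}M_i|w_{ji}|\Bigr)\le-\eta .$$ Then the network is $k$-contractive with rate $\eta$ with respect to the scaled norm $|\cdot|_{\infty,D}$, where $D:=\operatorname{diag}(d_1,\dots,d_n)$. Here, for a matrix $A$, the multiplicative compound $A^{(k)}$ is the matrix of all $k$-minors of $A$ (indexed by the increasing sequences of $k$ row and $k$ column indices), and for a square matrix $A$ the additive compound is $A^{[k]}:=\frac{d}{d\varepsilon}(I+\varepsilon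 A)^{(k)}\big|_{\varepsilon=0}$. The norm in question is the norm $|y|:=|D^{(k)}y|_\infty$ on $\mathbb R^{\binom nk}$; let $\|\cdot\|$ be the matrix norm it induces and $\mu(B):=\lim_{\varepsilon\downarrow0}(\|I+\varepsilon B\|-1)/\varepsilon$ the corresponding logarithmic norm. The conclusion means that, with $J(x)$ the Jacobian of the vector field of the network, 1. $\mu\bigl(J(x)^{[k]}\bigr)\le-\eta$ for all $x\in\mathbb R^n$; and 2. for every $a\in\mathbb R^n$ the solution $x(t,a)$ with $x(0,a)=a$ exists for all $t\ge0$, the map $a\mapsto x(t,a)$ is differentiable, and for all $t\ge0$, all $a\in\mathbb R^n$ and all $v^1,\dots,v^k\in\mathbb R^n$, $$\Bigl|\Bigl[\tfrac{\partial x(t,a)}{\partial a}v^1\ \cdots\ \tfrac{\partial x(t,a)}{\partial a}v^k\Bigr]^{(k)}\Bigr|\le e^{-\eta t}\,\Bigl|\bigl[v^1\ \cdots\ v^k\bigr]^{(k)}\Bigr| .$$ -/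

import Mathlib

open Filter Topology

noncomputable section

namespace KContraction

/-- `Q k n`: the increasing sequences of length `k` with entries in `{0, …, n - 1}`, which index
the `k`-minors. -/
abbrev Q (k n : ℕ) : Type := Fin k ↪o Fin n

instance instFintypeQ (k n : ℕ) : Fintype (Q k n) := Fintype.ofFinite _

instance instDecidableEqQ (k n : ℕ) : DecidableEq (Q k n) := Classical.decEq _

/-- The `k`-multiplicative compound `A^{(k)}`: its `(α, β)` entry is the minor of `A` with rows `α`
and columns `β`. -/
def mulCompound {n m : ℕ} (k : ℕ) (A : Matrix (Fin n) (Fin m) ℝ) : Matrix (Q k n) (Q k m) ℝ :=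
  Matrix.of fun α β => (A.submatrix α β).det

/-- The `k`-additive compound `A^{[k]} = d/dε (I + ε A)^{(k)}` at `ε = 0`, entrywise (each entry is
a polynomial in `ε`). -/
def addCompound {n : ℕ} (k : ℕ) (A : Matrix (Fin n) (Fin n) ℝ) : Matrix (Q k n) (Q k n) ℝ :=
  Matrix.of fun α β => deriv (fun ε : ℝ => mulCompound k (1 + ε • A) α β) 0

/-- The vector `[v¹ ⋯ vᵏ]^{(k)}` of all `k`-minors of the `n × k` matrix with columns
`v¹, …, vᵏ` (there is only one way to choose `k` increasing columns out of `k`). -/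
def wedge {n k : ℕ} (v : Fin k → Fin n → ℝ) : Q k n → ℝ := fun α =>
  mulCompound k (Matrix.of fun (i : Fin n) (j : Fin k) => v j i) α (RelEmbedding.refl _)

/-- The scaled norm `|y|_{∞,T} = |T y|_∞` (`‖·‖` on a finite product of copies of `ℝ` is the
supremum norm). -/
def scaledSupNorm {ι : Type} [Fintype ι] (T : Matrix ι ι ℝ) (y : ι → ℝ) : ℝ :=
  ‖T.mulVec y‖

/-- The matrix norm induced by a vector norm `N`: the maximum of `N (A x)` over `N x = 1`. -/
def inducedNorm {ι : Type} [Fintype ι] (N : (ι → ℝ) → ℝ) (A : Matrix ι ι ℝ) : ℝ :=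
  sSup {s : ℝ | ∃ x : ι → ℝ, N x = 1 ∧ s = N (A.mulVec x)}

/-- `c` is the log norm of `A` induced by the vector norm `N`, that is,
`c = lim_{ε ↓ 0} (‖I + ε A‖ - 1) / ε` and this limit exists. -/
def HasLogNorm {ι : Type} [Fintype ι] [DecidableEq ι] (N : (ι → ℝ) → ℝ) (A : Matrix ι ι ℝ)
    (c : ℝ) : Prop :=
  Tendsto (fun ε : ℝ => (inducedNorm N (1 + ε • A) - 1) / ε) (𝓝[>] 0) (𝓝 c)

/-- The Jacobian matrix of `f` at `x`. -/
def jacobian {n : ℕ} (f : (Fin n → ℝ) → (Fin n → ℝ)) (x : Fin n → ℝ) :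
    Matrix (Fin n) (Fin n) ℝ :=
  LinearMap.toMatrix' (fderiv ℝ f x : (Fin n → ℝ) →ₗ[ℝ] (Fin n → ℝ))

/-- The infinitesimal condition for `k`-contraction with rate `η` with respect to `N`:
`μ (J^{[k]}(x)) ≤ -η` for all `x`. -/
def InfinitesimallyKContractive {n : ℕ} (k : ℕ) (f : (Fin n → ℝ) → (Fin n → ℝ)) (η : ℝ)
    (N : (Q k n → ℝ) → ℝ) : Prop :=
  ∀ x, ∃ c : ℝ, HasLogNorm N (addCompound k (jacobian f x)) c ∧ c ≤ -η

/-- `X t a` is the value at time `t ≥ 0` of a solution of `x' = f x` with initial value `a`; all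
solutions exist on `[0, ∞)`. -/
def IsSolutionMap {n : ℕ} (f : (Fin n → ℝ) → (Fin n → ℝ)) (X : ℝ → (Fin n → ℝ) → (Fin n → ℝ)) :
    Prop :=
  ∀ a, X 0 a = a ∧ ∀ t ∈ Set.Ici (0 : ℝ), HasDerivWithinAt (fun s => X s a) (f (X t a)) (Set.Ici 0) t

/-- `x' = f x` is `k`-contractive with rate `η` with respect to the norm `N`: the solutions exist
for all `t ≥ 0`, they are differentiable in the initial condition, and the solution map contracts
`k`-dimensional (infinitesimal) parallelotopes, with edges `v¹, …, vᵏ` at `a`, at the exponential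
rate `η`. For a locally Lipschitz `f` the solution map `X` is unique at times `t ≥ 0`. -/
def IsKContractive {n : ℕ} (k : ℕ) (f : (Fin n → ℝ) → (Fin n → ℝ)) (η : ℝ)
    (N : (Q k n → ℝ) → ℝ) : Prop :=
  ∃ X : ℝ → (Fin n → ℝ) → (Fin n → ℝ), IsSolutionMap f X ∧
    ∀ t : ℝ, 0 ≤ t → ∀ a : Fin n → ℝ, DifferentiableAt ℝ (X t) a ∧
      ∀ v : Fin k → Fin n → ℝ,
        N (wedge fun j => fderiv ℝ (X t) a (v j)) ≤ Real.exp (-η * t) * N (wedge v)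

/-- The vector field of the Hopfield network. -/
def hopfield {n : ℕ} (r : Fin n → ℝ) (W : Matrix (Fin n) (Fin n) ℝ) (φ : Fin n → ℝ → ℝ)
    (u : Fin n → ℝ) (x : Fin n → ℝ) : Fin n → ℝ :=
  fun i => -(x i / r i) + ∑ j, W i j * φ j (x j) + u i

end KContraction

end

/-! Since `D` is diagonal, `D^{(k)}` is diagonal with entries `∏ i, d (α i)`, so the log norm of
`J^{[k]}` is the largest row value: diagonal entry plus scaled absolute off-diagonal entries. Off
the diagonal, `J^{[k]}` only exchanges one index `i ∈ α` for some `p ∉ α`, with entry `± J i p`, and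
all scaling factors but `d i / d p` cancel. Hence row `α` is at most `∑_{i∈α} (J i i + ∑_{p∉α} |J i
p| d i / d p)`.

Put `c j = -1/r j + M j |W j j|`, `l j = -1/r j - m j |W j j|` and `N = n - k`. Since `l p ≤ c p`,
the hypothesis at `p ∉ α` gives `∑_j c j - N c p + N ∑_{i∈α} (d i / d p) M p |W i p| ≤ -η`. Summing
over the `N` indices `p ∉ α` cancels the `c p` and leaves `N` times the bound of row `α`, so the row
is at most `-η` (`row_bound_of_column_bounds`).

For the flow, bounded `φ'` makes the field globally Lipschitz, so solutions are global and
differentiable in the initial value, the derivative solving the variational equation. The wedge of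
`k` variational solutions solves `y' = J^{[k]} y`, and Coppel's inequality turns the row bound into
the decay rate. -/

namespace KContraction

/-! ### Minors and the additive compound -/

variable {n k : ℕ}

/-- The minor with rows `f` (in any order, possibly repeated) of the matrix with columns `v`. -/
noncomputable def minorDet (v : Fin k → Fin n → ℝ) (f : Fin k → Fin n) : ℝ :=
  (Matrix.of fun i j => v j (f i)).det

theorem wedge_eq_minorDet (v : Fin k → Fin n → ℝ) (α : Q k n) : wedge v α = minorDet v α := rfl

theorem minorDet_eq_zero_of_not_injective (v : Fin k → Fin n → ℝ) {f : Fin k → Fin n}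
    (hf : ¬ Function.Injective f) : minorDet v f = 0 := by
  simp only [Function.Injective, not_forall] at hf
  obtain ⟨i, j, hij, hne⟩ := hf
  exact Matrix.det_zero_of_row_eq hne (by ext l; simp [hij])

theorem exists_eq_comp_perm {f : Fin k → Fin n} (hf : Function.Injective f) :
    ∃ (β : Q k n) (σ : Equiv.Perm (Fin k)), f = β ∘ σ := by
  have hc : (Finset.univ.image f).card = k := by
    rw [Finset.card_image_of_injective _ hf]; simp
  refine ⟨(Finset.univ.image f).orderEmbOfFin hc, ?_⟩
  have h : ∀ i, ∃ j, (Finset.univ.image f).orderEmbOfFin hc j = f i := by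
    intro i
    have : f i ∈ Set.range ((Finset.univ.image f).orderEmbOfFin hc) := by
      rw [Finset.range_orderEmbOfFin]; simp
    exact this
  choose s hs using h
  have hsi : Function.Injective s := fun i j hij => hf (by rw [← hs i, ← hs j, hij])
  refine ⟨Equiv.ofBijective s (Finite.injective_iff_bijective.1 hsi), ?_⟩
  ext i
  simp [hs]

theorem minorDet_comp_perm (v : Fin k → Fin n → ℝ) (f : Fin k → Fin n)
    (σ : Equiv.Perm (Fin k)) :
    minorDet v (f ∘ σ) = (Equiv.Perm.sign σ : ℤ) * minorDet v f :=
  Matrix.det_permute σ (Matrix.of fun i j => v j (f i))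

theorem orderEmb_eq_of_range_subset {α β : Q k n} (h : ∀ i, ∃ j, β j = α i) : α = β := by
  have hs : Set.range α ⊆ Set.range β := by
    rintro _ ⟨i, rfl⟩; exact h i
  have hr : Set.range α = Set.range β := by
    apply Set.eq_of_subset_of_ncard_le hs
    rw [Set.ncard_range_of_injective α.injective, Set.ncard_range_of_injective β.injective]
  exact DFunLike.coe_injective ((StrictMono.range_inj α.strictMono β.strictMono).1 hr)

theorem mulCompound_diagonal (d : Fin n → ℝ) :
    mulCompound k (Matrix.diagonal d) = Matrix.diagonal fun α : Q k n => ∏ i, d (α i) := by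
  ext α β
  by_cases h : α = β
  · subst h
    simp [mulCompound, Matrix.submatrix_diagonal _ _ α.injective]
  · rw [Matrix.diagonal_apply_ne _ h]
    obtain ⟨i, hi⟩ : ∃ i, ∀ j, β j ≠ α i := by
      by_contra! hc
      exact h (orderEmb_eq_of_range_subset hc)
    refine Matrix.det_eq_zero_of_row_eq_zero i fun j => ?_
    exact Matrix.diagonal_apply_ne _ (hi j).symm

/-- The standard basis vectors selected by `β`. -/
def basisVectors (β : Q k n) : Fin k → Fin n → ℝ := fun j => Pi.single (β j) 1

theorem minorDet_basisVectors (α β : Q k n) :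
    minorDet (basisVectors β) α = if α = β then 1 else 0 := by
  have h := congrFun (congrFun (mulCompound_diagonal (k := k) (fun _ : Fin n => (1 : ℝ))) α) β
  rw [Matrix.diagonal_apply] at h
  simp only [Finset.prod_const_one] at h
  rw [← h]
  unfold minorDet mulCompound basisVectors
  congr 1
  ext i j
  simp [Matrix.one_apply, Pi.single_apply]

/-- A minor is alternating in its row sequence, so an arbitrary sequence reduces, up to sign, to an
increasing one or to zero. This lets row replacements be read as linear combinations of wedge
coordinates. -/
theorem minorDet_eq_sum (v : Fin k → Fin n → ℝ) (f : Fin k → Fin n) :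
    minorDet v f = ∑ β : Q k n, minorDet (basisVectors β) f * wedge v β := by
  by_cases hf : Function.Injective f
  · obtain ⟨γ, σ, rfl⟩ := exists_eq_comp_perm hf
    simp [minorDet_comp_perm, minorDet_basisVectors, wedge_eq_minorDet]
  · simp [minorDet_eq_zero_of_not_injective _ hf]

/-- Only the increasing rearrangement of `f` contributes, with a minor equal to `±1`. -/
theorem sum_abs_minorDet_basisVectors {f : Fin k → Fin n} (hf : Function.Injective f)
    (d : Fin n → ℝ) :
    ∑ β : Q k n, |minorDet (basisVectors β) f| * ∏ i, d (β i) = ∏ i, d (f i) := by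
  obtain ⟨γ, σ, rfl⟩ := exists_eq_comp_perm hf
  have hs : |((Equiv.Perm.sign σ : ℤ) : ℝ)| = 1 := by
    rcases Int.units_eq_one_or (Equiv.Perm.sign σ) with h | h <;> simp [h]
  simp only [minorDet_comp_perm, abs_mul, hs, minorDet_basisVectors, one_mul]
  simp only [apply_ite abs, abs_one, abs_zero, ite_mul, one_mul, zero_mul, Finset.sum_ite_eq,
    Finset.mem_univ, if_true, Function.comp_apply]
  exact (Equiv.prod_comp σ fun i => d (γ i)).symm

/-- The determinant is multilinear in its rows. Differentiating row `f i` yields a combination of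
the rows `p` with weights `J (f i) p`, that is, minors with `f i` replaced by `p`. -/
theorem hasDerivWithinAt_minorDet {v : ℝ → Fin k → Fin n → ℝ} {J : Matrix (Fin n) (Fin n) ℝ}
    {s : Set ℝ} {t : ℝ} (hv : ∀ j, HasDerivWithinAt (fun τ => v τ j) (J.mulVec (v t j)) s t)
    (f : Fin k → Fin n) :
    HasDerivWithinAt (fun τ => minorDet (v τ) f)
      (∑ i, ∑ p, J (f i) p * minorDet (v t) (Function.update f i p)) s t := by
  let D : ContinuousMultilinearMap ℝ (fun _ : Fin k => Fin k → ℝ) ℝ :=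
    ⟨(Matrix.detRowAlternating (n := Fin k) (R := ℝ)).toMultilinearMap, by
      exact (continuous_id (X := Matrix (Fin k) (Fin k) ℝ)).matrix_det⟩
  have hm : HasDerivWithinAt (fun τ => fun i j => v τ j (f i))
      (fun i j => J.mulVec (v t j) (f i)) s t := by
    rw [hasDerivWithinAt_pi]; intro i
    rw [hasDerivWithinAt_pi]; intro j
    exact hasDerivWithinAt_pi.1 (hv j) (f i)
  have h := (D.hasStrictFDerivAt (fun i j => v t j (f i))).hasFDerivAt.comp_hasDerivWithinAt t hm
  refine h.congr_deriv ?_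
  rw [ContinuousMultilinearMap.linearDeriv_apply]
  refine Finset.sum_congr rfl fun i _ => ?_
  have hrow : (fun j => J.mulVec (v t j) (f i)) = ∑ p, J (f i) p • fun j => v t j p := by
    ext j
    simp [Matrix.mulVec, dotProduct]
  rw [hrow]
  refine (D.toMultilinearMap.map_update_sum _ _ _ _).trans ?_
  refine Finset.sum_congr rfl fun p _ => ?_
  refine (D.toMultilinearMap.map_update_smul _ _ _ _).trans ?_
  rw [smul_eq_mul]
  congr 1
  change Matrix.det _ = Matrix.det _
  congr 1
  ext a b
  by_cases h : a = i
  · subst h; simp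
  · simp [Function.update_of_ne h]

/-- The columns of `I + ε J` are the curves `e_j + ε J e_j`, so this is the minor derivative formula
at `ε = 0`. -/
theorem addCompound_apply (J : Matrix (Fin n) (Fin n) ℝ) (α β : Q k n) :
    addCompound k J α β =
      ∑ i, ∑ p, J (α i) p * minorDet (basisVectors β) (Function.update α i p) := by
  let v : ℝ → Fin k → Fin n → ℝ := fun ε j => basisVectors β j + ε • J.mulVec (basisVectors β j)
  have h0 : v 0 = basisVectors β := by funext j; simp [v]
  have hv : ∀ j, HasDerivWithinAt (fun τ => v τ j) (J.mulVec (v 0 j)) Set.univ 0 := by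
    intro j
    rw [h0]
    have h := ((hasDerivAt_id (0 : ℝ)).smul_const
      (J.mulVec (basisVectors β j))).const_add (basisVectors β j)
    rw [one_smul] at h
    exact h.hasDerivWithinAt
  have h := hasDerivWithinAt_univ.1 (hasDerivWithinAt_minorDet hv α)
  rw [h0] at h
  rw [← h.deriv]
  change deriv _ _ = _
  congr 1
  funext ε
  unfold mulCompound minorDet
  simp only [Matrix.of_apply]
  congr 1
  ext i j
  simp [v, basisVectors, Matrix.one_apply, Pi.single_apply]

theorem addCompound_mulVec_wedge (J : Matrix (Fin n) (Fin n) ℝ) (v : Fin k → Fin n → ℝ)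
    (α : Q k n) :
    (addCompound k J).mulVec (wedge v) α =
      ∑ i, ∑ p, J (α i) p * minorDet v (Function.update α i p) := by
  simp only [Matrix.mulVec, dotProduct, addCompound_apply, Finset.sum_mul]
  rw [Finset.sum_comm]
  refine Finset.sum_congr rfl fun i _ => ?_
  rw [Finset.sum_comm]
  refine Finset.sum_congr rfl fun p _ => ?_
  rw [minorDet_eq_sum v, Finset.mul_sum]
  exact Finset.sum_congr rfl fun β _ => by ring

theorem hasDerivWithinAt_wedge {v : ℝ → Fin k → Fin n → ℝ} {J : Matrix (Fin n) (Fin n) ℝ}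
    {s : Set ℝ} {t : ℝ} (hv : ∀ j, HasDerivWithinAt (fun τ => v τ j) (J.mulVec (v t j)) s t) :
    HasDerivWithinAt (fun τ => wedge (v τ)) ((addCompound k J).mulVec (wedge (v t))) s t := by
  rw [hasDerivWithinAt_pi]
  intro α
  rw [addCompound_mulVec_wedge]
  exact hasDerivWithinAt_minorDet hv α

/-- Off-diagonal row bound for the additive compound in the scaled coordinates. -/
theorem scaled_addCompound_row_le (J : Matrix (Fin n) (Fin n) ℝ) {d : Fin n → ℝ}
    (hd : ∀ i, 0 < d i) (α : Q k n) :
    addCompound k J α α + ∑ β ∈ Finset.univ.erase α,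
        (∏ i, d (α i)) * |addCompound k J α β| / ∏ i, d (β i) ≤
      ∑ i, (J (α i) (α i) +
        ∑ p ∈ Finset.univ.filter (fun p => ∀ j, α j ≠ p), |J (α i) p| * (d (α i) / d p)) := by
  set P := Finset.univ.filter (fun p => ∀ j, α j ≠ p) with hP
  set R : Q k n → ℝ := fun β =>
    ∑ i, ∑ p ∈ P, J (α i) p * minorDet (basisVectors β) (Function.update α i p) with hR
  have hsplit : ∀ β, addCompound k J α β =
      (if α = β then ∑ i, J (α i) (α i) else 0) + R β := by
    intro β
    rw [addCompound_apply, hR]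
    have : (if α = β then ∑ i, J (α i) (α i) else 0) =
        ∑ i, J (α i) (α i) * minorDet (basisVectors β) α := by
      rw [minorDet_basisVectors]; split_ifs <;> simp
    rw [this, ← Finset.sum_add_distrib]
    refine Finset.sum_congr rfl fun i _ => ?_
    have hi : α i ∉ P := by simp [hP]
    have hu : Function.update α i (α i) = α := Function.update_eq_self i α
    have := Finset.sum_insert (f := fun p => J (α i) p *
      minorDet (basisVectors β) (Function.update α i p)) hi
    simp only [hu] at this
    rw [← this]
    symm
    -- An index `p` already in `α`, other than `α i`, would repeat a row, so its minor vanishes.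
    refine Finset.sum_subset (Finset.subset_univ _) fun p _ hp => ?_
    simp only [hP, Finset.mem_insert, Finset.mem_filter, Finset.mem_univ, true_and, not_or,
      not_forall, not_not] at hp
    obtain ⟨h1, j, hj⟩ := hp
    rw [minorDet_eq_zero_of_not_injective, mul_zero]
    intro hinj
    have hji : j ≠ i := by rintro rfl; exact h1 hj.symm
    exact hji (hinj (by simp [Function.update_of_ne hji, hj]))
  have hpos : ∀ β : Q k n, 0 < ∏ i, d (β i) := fun β => Finset.prod_pos fun i _ => hd _
  have hone : addCompound k J α α = (∑ i, J (α i) (α i)) + R α := by rw [hsplit, if_pos rfl]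
  have h1 : addCompound k J α α + ∑ β ∈ Finset.univ.erase α,
        (∏ i, d (α i)) * |addCompound k J α β| / ∏ i, d (β i) ≤
      (∑ i, J (α i) (α i)) + ∑ β, (∏ i, d (α i)) * |R β| / ∏ i, d (β i) := by
    rw [← Finset.add_sum_erase _ (fun β => (∏ i, d (α i)) * |R β| / ∏ i, d (β i))
      (Finset.mem_univ α), ← add_assoc, hone]
    refine add_le_add (add_le_add le_rfl ?_) ?_
    · rw [mul_comm, mul_div_assoc, div_self (hpos α).ne', mul_one]
      exact le_abs_self _
    · refine Finset.sum_le_sum fun β hβ => ?_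
      rw [hsplit, if_neg (Finset.ne_of_mem_erase hβ).symm, zero_add]
  refine h1.trans ?_
  rw [Finset.sum_add_distrib]
  gcongr
  have h2 : ∀ β, (∏ i, d (α i)) * |R β| / ∏ i, d (β i) ≤
      ∑ i, ∑ p ∈ P, |J (α i) p| * ((∏ i, d (α i)) *
        (|minorDet (basisVectors β) (Function.update α i p)| * ∏ i, (d (β i))⁻¹)) := by
    intro β
    have : |R β| ≤ ∑ i, ∑ p ∈ P,
        |J (α i) p| * |minorDet (basisVectors β) (Function.update α i p)| := by
      refine (Finset.abs_sum_le_sum_abs _ _).trans (Finset.sum_le_sum fun i _ => ?_)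
      refine (Finset.abs_sum_le_sum_abs _ _).trans (Finset.sum_le_sum fun p _ => ?_)
      rw [abs_mul]
    rw [div_eq_mul_inv, ← Finset.prod_inv_distrib]
    calc _ ≤ (∏ i, d (α i)) * (∑ i, ∑ p ∈ P,
        |J (α i) p| * |minorDet (basisVectors β) (Function.update α i p)|) *
          ∏ i, (d (β i))⁻¹ := by
          have := hpos α
          have h3 : 0 ≤ ∏ i, (d (β i))⁻¹ := Finset.prod_nonneg fun i _ => (inv_pos.2 (hd _)).le
          gcongr
      _ = _ := by
          simp only [Finset.mul_sum, Finset.sum_mul]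
          exact Finset.sum_congr rfl fun i _ => Finset.sum_congr rfl fun p _ => by ring
  refine (Finset.sum_le_sum fun β _ => h2 β).trans (le_of_eq ?_)
  rw [Finset.sum_comm]
  refine Finset.sum_congr rfl fun i _ => ?_
  rw [Finset.sum_comm]
  refine Finset.sum_congr rfl fun p hp => ?_
  have hp' : ∀ j, α j ≠ p := by simpa [hP] using hp
  have hinj : Function.Injective (Function.update α i p) := by
    intro a b hab
    by_cases ha : a = i <;> by_cases hb : b = i
    · rw [ha, hb]
    · subst ha; rw [Function.update_self, Function.update_of_ne hb] at hab
      exact absurd hab.symm (hp' b)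
    · subst hb; rw [Function.update_self, Function.update_of_ne ha] at hab
      exact absurd hab (hp' a)
    · rw [Function.update_of_ne ha, Function.update_of_ne hb] at hab
      exact α.injective hab
  rw [← Finset.mul_sum, ← Finset.mul_sum,
    sum_abs_minorDet_basisVectors hinj fun p => (d p)⁻¹, ← Finset.prod_mul_distrib]
  congr 1
  -- The weights of the unchanged indices cancel, leaving `d (α i) / d p`.
  rw [Finset.prod_eq_single i]
  · simp [div_eq_mul_inv]
  · intro b _ hb
    rw [Function.update_of_ne hb, mul_inv_cancel₀ (hd _).ne']
  · simp

end KContraction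

/-! ### Log norms and Coppel's inequality -/

namespace KContraction

theorem scaledSupNorm_nonneg {ι : Type} [Fintype ι] (T : Matrix ι ι ℝ) (x : ι → ℝ) : 0 ≤ scaledSupNorm T x :=
  norm_nonneg _

theorem eventually_one_add_mul_nonneg {ι : Type} [Finite ι] (A : Matrix ι ι ℝ) :
    ∀ᶠ ε : ℝ in 𝓝[>] 0, ∀ α, 0 ≤ 1 + ε * A α α := by
  rw [eventually_all]
  intro α
  have h : Tendsto (fun ε : ℝ => 1 + ε * A α α) (𝓝[>] 0) (𝓝 (1 + 0 * A α α)) :=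
    (Continuous.tendsto (by fun_prop) 0).mono_left nhdsWithin_le_nhds
  filter_upwards [h.eventually (lt_mem_nhds (show (0 : ℝ) < 1 + 0 * A α α by norm_num))] with ε hε
  exact hε.le

section LogNorm

variable {ι : Type} [Fintype ι] [DecidableEq ι]

/-- The log norm of the row `α` of `A` in the coordinates scaled by `T`. -/
noncomputable def rowLogNorm (T : ι → ℝ) (A : Matrix ι ι ℝ) (α : ι) : ℝ :=
  A α α + ∑ β ∈ Finset.univ.erase α, T α * |A α β| / T β

/-- As long as the diagonal entry of `1 + ε A` is nonnegative, its absolute value can be dropped, so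
the row sum is affine in `ε`. -/
theorem sum_abs_one_add_smul {T : ι → ℝ} (hT : ∀ i, 0 < T i) {A : Matrix ι ι ℝ} {ε : ℝ}
    (hε : 0 ≤ ε) (α : ι) (h : 0 ≤ 1 + ε * A α α) :
    ∑ β, T α * |(1 + ε • A) α β| / T β = 1 + ε * rowLogNorm T A α := by
  rw [← Finset.add_sum_erase _ _ (Finset.mem_univ α), rowLogNorm, mul_add, ← add_assoc,
    Finset.mul_sum]
  congr 1
  · have := (hT α).ne'
    simp only [Matrix.add_apply, Matrix.one_apply_eq, Matrix.smul_apply, smul_eq_mul]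
    rw [abs_of_nonneg h]
    field_simp
  · refine Finset.sum_congr rfl fun β hβ => ?_
    have hne : α ≠ β := (Finset.ne_of_mem_erase hβ).symm
    simp only [Matrix.add_apply, Matrix.one_apply_ne hne, Matrix.smul_apply, smul_eq_mul, zero_add,
      abs_mul, abs_of_nonneg hε]
    ring

theorem abs_mul_mulVec_le {T : ι → ℝ} (hT : ∀ i, 0 < T i) (B : Matrix ι ι ℝ) (x : ι → ℝ)
    (α : ι) :
    |T α * B.mulVec x α| ≤
      (∑ β, T α * |B α β| / T β) * scaledSupNorm (Matrix.diagonal T) x := by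
  rw [Matrix.mulVec, dotProduct, Finset.mul_sum, Finset.sum_mul]
  refine (Finset.abs_sum_le_sum_abs _ _).trans (Finset.sum_le_sum fun β _ => ?_)
  have h1 : |T β * x β| ≤ scaledSupNorm (Matrix.diagonal T) x := by
    have := norm_le_pi_norm ((Matrix.diagonal T).mulVec x) β
    rwa [Matrix.mulVec_diagonal] at this
  have hα := hT α
  have hβ := hT β
  calc |T α * (B α β * x β)| = T α * |B α β| / T β * |T β * x β| := by
        rw [abs_mul, abs_mul, abs_mul, abs_of_pos hα, abs_of_pos hβ]; field_simp
    _ ≤ _ := by gcongr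

theorem inducedNorm_eq_of_max_row [Nonempty ι] {T : ι → ℝ} (hT : ∀ i, 0 < T i)
    (B : Matrix ι ι ℝ) (α₀ : ι)
    (hmax : ∀ α, ∑ β, T α * |B α β| / T β ≤ ∑ β, T α₀ * |B α₀ β| / T β) :
    inducedNorm (scaledSupNorm (Matrix.diagonal T)) B = ∑ β, T α₀ * |B α₀ β| / T β := by
  have hub : ∀ x, scaledSupNorm (Matrix.diagonal T) x = 1 →
      scaledSupNorm (Matrix.diagonal T) (B.mulVec x) ≤ ∑ β, T α₀ * |B α₀ β| / T β := by
    intro x hx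
    refine (pi_norm_le_iff_of_nonempty _).2 fun α => ?_
    rw [Matrix.mulVec_diagonal, Real.norm_eq_abs]
    have := abs_mul_mulVec_le hT B x α
    rw [hx, mul_one] at this
    exact this.trans (hmax α)
  refine IsGreatest.csSup_eq ⟨?_, ?_⟩
  -- The sign pattern of the maximal row, rescaled to norm one, attains the bound.
  · let x : ι → ℝ := fun β => (if 0 ≤ B α₀ β then 1 else -1) / T β
    have hx : scaledSupNorm (Matrix.diagonal T) x = 1 := by
      have h : ∀ β, ‖(Matrix.diagonal T).mulVec x β‖ = 1 := by
        intro β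
        rw [Matrix.mulVec_diagonal, mul_div_cancel₀ _ (hT β).ne']
        split_ifs <;> simp
      refine le_antisymm ((pi_norm_le_iff_of_nonempty _).2 fun β => (h β).le) ?_
      rw [← h α₀]
      exact norm_le_pi_norm _ α₀
    refine ⟨x, hx, le_antisymm ?_ (hub x hx)⟩
    refine le_trans (le_of_eq ?_) (norm_le_pi_norm _ α₀)
    have : ∑ β, T α₀ * |B α₀ β| / T β = T α₀ * B.mulVec x α₀ := by
      rw [Matrix.mulVec, dotProduct, Finset.mul_sum]
      refine Finset.sum_congr rfl fun β _ => ?_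
      simp only [x]
      split_ifs with h
      · rw [abs_of_nonneg h]; ring
      · rw [abs_of_neg (not_le.1 h)]; ring
    rw [Matrix.mulVec_diagonal, ← this, Real.norm_eq_abs, abs_of_nonneg]
    exact Finset.sum_nonneg fun β _ => by have := hT α₀; have := hT β; positivity
  · rintro s ⟨x, hx, rfl⟩
    exact hub x hx

theorem exists_hasLogNorm_scaledSupNorm_le [Nonempty ι] {T : ι → ℝ} (hT : ∀ i, 0 < T i)
    (A : Matrix ι ι ℝ) {b : ℝ} (hb : ∀ α, rowLogNorm T A α ≤ b) :
    ∃ c, HasLogNorm (scaledSupNorm (Matrix.diagonal T)) A c ∧ c ≤ b := by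
  obtain ⟨α₀, hα₀⟩ := Finite.exists_max (rowLogNorm T A)
  refine ⟨rowLogNorm T A α₀, ?_, hb α₀⟩
  -- For small `ε > 0` the same row is maximal for every `1 + ε A`, so the difference quotient is
  -- constant.
  refine tendsto_const_nhds.congr' ?_
  filter_upwards [eventually_one_add_mul_nonneg A, self_mem_nhdsWithin] with ε h hpos
  have hε : 0 < ε := hpos
  rw [inducedNorm_eq_of_max_row hT _ α₀, sum_abs_one_add_smul hT hε.le α₀ (h α₀)]
  · field_simp; ring
  · intro α
    rw [sum_abs_one_add_smul hT hε.le α (h α), sum_abs_one_add_smul hT hε.le α₀ (h α₀)]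
    gcongr
    exact hα₀ α

/-- Coppel's inequality for the scaled supremum norm. -/
theorem scaledSupNorm_le_exp_mul [Nonempty ι] {T : ι → ℝ} (hT : ∀ i, 0 < T i)
    {A : ℝ → Matrix ι ι ℝ} {y : ℝ → ι → ℝ} {t₁ c : ℝ} (ht₁ : 0 ≤ t₁)
    (hy : ContinuousOn y (Set.Icc 0 t₁))
    (hy' : ∀ t ∈ Set.Ico 0 t₁, HasDerivWithinAt y ((A t).mulVec (y t)) (Set.Ici t) t)
    (hA : ∀ t ∈ Set.Ico 0 t₁, ∀ α, rowLogNorm T (A t) α ≤ c) :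
    scaledSupNorm (Matrix.diagonal T) (y t₁) ≤
      Real.exp (c * t₁) * scaledSupNorm (Matrix.diagonal T) (y 0) := by
  set N := scaledSupNorm (Matrix.diagonal T) with hN
  have hNc : Continuous N := by
    have : Continuous fun x : ι → ℝ => ‖(Matrix.diagonal T).mulVec x‖ :=
      (Continuous.matrix_mulVec continuous_const continuous_id).norm
    exact this
  have key := le_gronwallBound_of_liminf_deriv_right_le (f := fun t => N (y t))
    (f' := fun t => c * N (y t)) (δ := N (y 0)) (K := c) (ε := 0) (a := 0) (b := t₁)
    (hNc.comp_continuousOn hy) ?_ le_rfl (fun t _ => by simp) t₁ ⟨ht₁, le_rfl⟩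
  · rw [gronwallBound_ε0, sub_zero, mul_comm] at key
    exact key
  intro t ht r hr
  refine Eventually.frequently ?_
  -- first-order remainder of `y` at `t`
  set q : ℝ → ℝ := fun z => N ((z - t)⁻¹ • (y z - y t) - (A t).mulVec (y t)) with hq
  have hslope := (hasDerivWithinAt_iff_tendsto_slope' (by simp)).1 ((hy' t ht).Ioi_of_Ici)
  have hqt : Tendsto q (𝓝[>] t) (𝓝 0) := by
    have h1 : Tendsto (fun z => slope y t z - (A t).mulVec (y t)) (𝓝[>] t) (𝓝 0) := by
      simpa using hslope.sub_const ((A t).mulVec (y t))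
    have h2 := (hNc.tendsto 0).comp h1
    have h0 : N 0 = 0 := by simp [hN, scaledSupNorm]
    rw [h0] at h2
    exact h2
  have hev : Tendsto (fun z : ℝ => z - t) (𝓝[>] t) (𝓝[>] 0) := by
    refine tendsto_nhdsWithin_iff.2 ⟨?_, ?_⟩
    · have : Tendsto (fun z : ℝ => z - t) (𝓝 t) (𝓝 (t - t)) :=
        (Continuous.tendsto (by fun_prop) t)
      rw [sub_self] at this
      exact this.mono_left nhdsWithin_le_nhds
    · filter_upwards [self_mem_nhdsWithin] with z hz
      exact Set.mem_Ioi.2 (sub_pos.2 (Set.mem_Ioi.1 hz))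
  filter_upwards [hev.eventually (eventually_one_add_mul_nonneg (A t)),
    hqt.eventually (gt_mem_nhds (sub_pos.2 hr)), self_mem_nhdsWithin] with z h1 h2 hz
  have hpos : 0 < z - t := sub_pos.2 hz
  set h := z - t with hh
  have hdecomp : y z = (1 + h • A t).mulVec (y t) +
      h • (h⁻¹ • (y z - y t) - (A t).mulVec (y t)) := by
    rw [smul_sub, smul_smul, mul_inv_cancel₀ hpos.ne', one_smul, Matrix.add_mulVec,
      Matrix.one_mulVec, Matrix.smul_mulVec]
    abel
  have hle1 : N ((1 + h • A t).mulVec (y t)) ≤ (1 + h * c) * N (y t) := by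
    refine (pi_norm_le_iff_of_nonempty _).2 fun α => ?_
    rw [Matrix.mulVec_diagonal, Real.norm_eq_abs]
    refine (abs_mul_mulVec_le hT _ _ α).trans ?_
    rw [sum_abs_one_add_smul hT hpos.le α (h1 α)]
    have := hA t ht α
    have hn : 0 ≤ N (y t) := scaledSupNorm_nonneg _ _
    gcongr
  have hle2 : N (y z) ≤ (1 + h * c) * N (y t) + h * q z := by
    have htri : N (y z) ≤ N ((1 + h • A t).mulVec (y t)) +
        N (h • (h⁻¹ • (y z - y t) - (A t).mulVec (y t))) := by
      conv_lhs => rw [hdecomp]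
      simp only [hN, scaledSupNorm, Matrix.mulVec_add]
      exact norm_add_le _ _
    have hs : N (h • (h⁻¹ • (y z - y t) - (A t).mulVec (y t))) = h * q z := by
      simp only [hq, hN, scaledSupNorm, Matrix.mulVec_smul, norm_smul, Real.norm_eq_abs,
        abs_of_pos hpos, ← hh]
    linarith
  have hlt : N (y z) - N (y t) < h * r := by nlinarith
  rw [inv_mul_lt_iff₀ hpos]
  exact hlt

end LogNorm

end KContraction

namespace KContraction

/-! ### Global solutions and differentiability in the initial value -/

section Flow

open Set NNReal

variable {n : ℕ}

/-- Coordinatewise truncation to `[-R, R]`. -/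
def clamp (R : ℝ) (x : Fin n → ℝ) : Fin n → ℝ := fun i => max (-R) (min R (x i))

theorem lipschitzWith_clamp (R : ℝ) : LipschitzWith 1 (clamp R : (Fin n → ℝ) → Fin n → ℝ) := by
  refine LipschitzWith.of_dist_le_mul fun x y => ?_
  rw [NNReal.coe_one, one_mul]
  refine (dist_pi_le_iff dist_nonneg).2 fun i => ?_
  refine le_trans ?_ (dist_le_pi_dist x y i)
  have h : LipschitzWith 1 fun z : ℝ => max (-R) (min R z) :=
    (LipschitzWith.id.const_min R).const_max (-R)
  simpa [clamp] using h.dist_le_mul (x i) (y i)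

theorem norm_clamp_le {R : ℝ} (hR : 0 ≤ R) (x : Fin n → ℝ) : ‖clamp R x‖ ≤ R := by
  refine (pi_norm_le_iff_of_nonneg hR).2 fun i => ?_
  rw [Real.norm_eq_abs, abs_le]
  exact ⟨le_max_left _ _, max_le (by linarith) (min_le_left _ _)⟩

theorem clamp_eq_self {R : ℝ} {x : Fin n → ℝ} (hx : ‖x‖ ≤ R) : clamp R x = x := by
  funext i
  have := abs_le.1 ((norm_le_pi_norm x i).trans hx)
  rw [clamp, min_eq_right this.2, max_eq_right this.1]

theorem norm_clamp_le_norm {R : ℝ} (hR : 0 ≤ R) (x : Fin n → ℝ) : ‖clamp R x‖ ≤ ‖x‖ := by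
  have h := (lipschitzWith_clamp R).dist_le_mul x 0
  rwa [clamp_eq_self (x := 0) (by simpa using hR), dist_zero_right, dist_zero_right, NNReal.coe_one,
    one_mul] at h

/-- A time-dependent, globally Lipschitz vector field has solutions on every `[0, T]`. -/
theorem exists_solution_Icc {v : ℝ → (Fin n → ℝ) → Fin n → ℝ} {K : ℝ≥0} {T : ℝ} (hT : 0 ≤ T)
    (hL : ∀ t ∈ Icc 0 T, LipschitzWith K (v t))
    (hc : ∀ x, ContinuousOn (fun t => v t x) (Icc 0 T)) (x₀ : Fin n → ℝ) :
    ∃ y : ℝ → Fin n → ℝ, y 0 = x₀ ∧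
      ∀ t ∈ Icc 0 T, HasDerivWithinAt y (v t (y t)) (Icc 0 T) t := by
  obtain ⟨B, hB⟩ := isCompact_Icc.exists_bound_of_continuousOn (hc 0)
  have hB0 : 0 ≤ B := (norm_nonneg _).trans (hB 0 ⟨le_rfl, hT⟩)
  have hmono : Monotone (gronwallBound ‖x₀‖ K B) :=
    gronwallBound_mono (norm_nonneg _) hB0 K.2
  -- `R` is the a priori Grönwall bound of any solution. Truncating the field outside the cube of
  -- radius `R` makes it bounded, hence Picard–Lindelöf covers all of `[0, T]`, and the solution
  -- never notices the truncation.
  set R := gronwallBound ‖x₀‖ K B T with hRdef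
  have hR : 0 ≤ R := by
    refine (norm_nonneg x₀).trans ?_
    have := hmono hT
    rwa [gronwallBound_x0] at this
  have hgrow : ∀ t ∈ Icc 0 T, ∀ x, ‖v t x‖ ≤ K * ‖x‖ + B := by
    intro t ht x
    have h1 := (hL t ht).norm_sub_le x 0
    rw [sub_zero] at h1
    have h2 := norm_le_norm_add_norm_sub' (v t x) (v t 0)
    linarith [hB t ht]
  set w : ℝ → (Fin n → ℝ) → Fin n → ℝ := fun t x => v t (clamp R x) with hw
  set L : ℝ≥0 := K * ⟨R, hR⟩ + ⟨B, hB0⟩ with hLdef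
  have hpl : IsPicardLindelof w (tmin := 0) (tmax := T) ⟨0, le_rfl, hT⟩ x₀ (L * ⟨T, hT⟩) 0 L K := by
    refine ⟨fun t ht => ?_, fun x _ => hc _, fun t ht x _ => ?_, ?_⟩
    · have := (hL t ht).comp (lipschitzWith_clamp R)
      rw [mul_one] at this
      exact this.lipschitzOnWith
    · refine (hgrow t ht _).trans ?_
      have h1 := mul_le_mul_of_nonneg_left (norm_clamp_le hR x) K.2
      rw [hLdef]
      exact add_le_add h1 le_rfl
    · rw [max_eq_left (by simpa using hT), sub_zero, NNReal.coe_zero, sub_zero]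
      exact le_rfl
  obtain ⟨y, hy0, hy⟩ := hpl.exists_eq_forall_mem_Icc_hasDerivWithinAt₀
  have hy0' : y 0 = x₀ := hy0
  refine ⟨y, hy0', fun t ht => ?_⟩
  have hbound : ‖y t‖ ≤ R := by
    have h1 := norm_le_gronwallBound_of_norm_deriv_right_le (f := y)
      (f' := fun t => w t (y t)) (δ := ‖x₀‖) (K := K) (ε := B) (a := 0) (b := T)
      (fun t ht => (hy t ht).continuousWithinAt)
      (fun t ht => (hy t (Ico_subset_Icc_self ht)).mono_of_mem_nhdsWithin
        (Icc_mem_nhdsGE_of_mem ht))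
      (by rw [hy0'])
      (fun t ht => (hgrow t (Ico_subset_Icc_self ht) _).trans (by
        have := mul_le_mul_of_nonneg_left (norm_clamp_le_norm hR (y t)) K.2
        exact add_le_add this le_rfl)) t ht
    rw [sub_zero] at h1
    exact h1.trans (hmono ht.2)
  have := hy t ht
  simp only [hw, clamp_eq_self hbound] at this
  exact this

theorem exists_isSolutionMap {f : (Fin n → ℝ) → Fin n → ℝ} {K : ℝ≥0} (hf : LipschitzWith K f) :
    ∃ X, IsSolutionMap f X := by
  have h : ∀ (a : Fin n → ℝ) (T : ℝ), ∃ y : ℝ → Fin n → ℝ, 0 ≤ T → y 0 = a ∧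
      ∀ t ∈ Icc 0 T, HasDerivWithinAt y (f (y t)) (Icc 0 T) t := by
    intro a T
    by_cases hT : 0 ≤ T
    · obtain ⟨y, hy⟩ := exists_solution_Icc (v := fun _ => f) hT (fun _ _ => hf)
        (fun _ => continuousOn_const) a
      exact ⟨y, fun _ => hy⟩
    · exact ⟨0, fun h => absurd h hT⟩
  choose y hy using h
  have hagree : ∀ a T T', 0 ≤ T → T ≤ T' → y a T T = y a T' T := by
    intro a T T' hT hTT'
    have h1 := hy a T hT
    have h2 := hy a T' (hT.trans hTT')
    refine ODE_solution_unique (v := fun _ => f) (K := K) (fun _ => hf) (a := 0) (b := T)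
      (fun t ht => (h1.2 t ht).continuousWithinAt)
      (fun t ht => (h1.2 t (Ico_subset_Icc_self ht)).mono_of_mem_nhdsWithin
        (Icc_mem_nhdsGE_of_mem ht))
      (fun t ht => ((h2.2 t ⟨ht.1, ht.2.trans hTT'⟩).continuousWithinAt).mono
        (Icc_subset_Icc_right hTT'))
      (fun t ht => (h2.2 t ⟨ht.1, ht.2.le.trans hTT'⟩).mono_of_mem_nhdsWithin
        (Icc_mem_nhdsGE_of_mem ⟨ht.1, ht.2.trans_le hTT'⟩))
      (h1.1.trans h2.1.symm) ⟨hT, le_rfl⟩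
  -- The solutions on the intervals `[0, T]` agree by uniqueness; near `t` the diagonal coincides
  -- with the solution on `[0, t + 1]`.
  refine ⟨fun t a => y a t t, fun a => ⟨(hy a 0 le_rfl).1, fun t ht => ?_⟩⟩
  have ht0 : (0 : ℝ) ≤ t := ht
  have h1 := (hy a (t + 1) (by linarith)).2 t ⟨ht0, by linarith⟩
  change HasDerivWithinAt (fun s => y a s s) (f (y a t t)) (Ici 0) t
  rw [hagree a t (t + 1) ht0 (by linarith)]
  have hmem : Icc 0 (t + 1) ∈ 𝓝[Ici 0] t := by
    have : Iio (t + 1) ∈ 𝓝 t := Iio_mem_nhds (by linarith)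
    filter_upwards [self_mem_nhdsWithin, mem_nhdsWithin_of_mem_nhds this] with s h1 h2
    exact ⟨h1, le_of_lt h2⟩
  refine (h1.mono_of_mem_nhdsWithin hmem).congr_of_eventuallyEq ?_
    (hagree a t (t + 1) ht0 (by linarith))
  filter_upwards [hmem] with s hs
  exact hagree a s (t + 1) hs.1 hs.2

theorem IsSolutionMap.hasDerivWithinAt_Ici {f : (Fin n → ℝ) → Fin n → ℝ}
    {X : ℝ → (Fin n → ℝ) → Fin n → ℝ} (hX : IsSolutionMap f X) (a : Fin n → ℝ) {t : ℝ}
    (ht : 0 ≤ t) : HasDerivWithinAt (fun s => X s a) (f (X t a)) (Ici t) t :=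
  ((hX a).2 t ht).mono (Ici_subset_Ici.2 ht)

theorem IsSolutionMap.continuousOn {f : (Fin n → ℝ) → Fin n → ℝ}
    {X : ℝ → (Fin n → ℝ) → Fin n → ℝ} (hX : IsSolutionMap f X) (a : Fin n → ℝ) :
    ContinuousOn (fun s => X s a) (Ici 0) :=
  fun t ht => ((hX a).2 t ht).continuousWithinAt

/-- Linear non-autonomous systems have a fundamental solution on `[0, T]`. -/
theorem exists_fundamental_solution {A : ℝ → (Fin n → ℝ) →L[ℝ] Fin n → ℝ} {T : ℝ} (hT : 0 ≤ T)
    (hA : ContinuousOn A (Icc 0 T)) :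
    ∃ Φ : ℝ → (Fin n → ℝ) →L[ℝ] Fin n → ℝ, (∀ h, Φ 0 h = h) ∧
      ∀ t ∈ Icc 0 T, ∀ h, HasDerivWithinAt (fun s => Φ s h) (A t (Φ t h)) (Icc 0 T) t := by
  obtain ⟨B, hB⟩ := isCompact_Icc.exists_bound_of_continuousOn hA
  have hB0 : 0 ≤ B := (norm_nonneg _).trans (hB 0 ⟨le_rfl, hT⟩)
  have hex := fun i : Fin n => exists_solution_Icc (v := fun t x => A t x) (K := ⟨B, hB0⟩) hT
    (fun t ht => (A t).lipschitz.weaken (by exact_mod_cast hB t ht))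
    (fun x => hA.clm_apply continuousOn_const) (Pi.single i 1)
  choose ψ hψ0 hψ using hex
  refine ⟨fun t => ∑ i, (ContinuousLinearMap.proj (R := ℝ) i).smulRight (ψ i t), fun h => ?_,
    fun t ht h => ?_⟩
  · simp only [sum_apply, ContinuousLinearMap.smulRight_apply,
      ContinuousLinearMap.proj_apply, hψ0]
    exact (pi_eq_sum_univ' h).symm
  · simp only [sum_apply, ContinuousLinearMap.smulRight_apply,
      ContinuousLinearMap.proj_apply, map_sum, map_smul]
    exact HasDerivWithinAt.fun_sum fun i _ => (hψ i t ht).const_smul (h i)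

theorem gronwallBound_zero_eq_mul (K ε x : ℝ) :
    gronwallBound 0 K ε x = ε * gronwallBound 0 K 1 x := by
  unfold gronwallBound
  split_ifs <;> ring

/-- Compactness gives one `δ` for the continuity of `fderiv ℝ f` at all points of `S`; the mean
value inequality on balls does the rest. It is applied along a trajectory. -/
theorem exists_uniform_linearization {f : (Fin n → ℝ) → Fin n → ℝ} (hf : ContDiff ℝ 1 f)
    {S : Set (Fin n → ℝ)} (hS : IsCompact S) {ε : ℝ} (hε : 0 < ε) :
    ∃ δ > 0, ∀ x ∈ S, ∀ y, dist y x < δ → ‖f y - f x - fderiv ℝ f x (y - x)‖ ≤ ε * ‖y - x‖ := by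
  have hc : Continuous (fderiv ℝ f) := hf.continuous_fderiv one_ne_zero
  have h := hS.uniformContinuousAt_of_continuousAt (fderiv ℝ f) (fun x _ => hc.continuousAt)
    (Metric.dist_mem_uniformity hε)
  obtain ⟨δ, hδ, h⟩ := Metric.mem_uniformity_dist.1 h
  refine ⟨δ, hδ, fun x hx y hy => ?_⟩
  refine (convex_ball x δ).norm_image_sub_le_of_norm_fderiv_le'
    (fun z _ => (hf.differentiable one_ne_zero).differentiableAt) (fun z hz => ?_)
    (Metric.mem_ball_self hδ) hy
  have := h (a := x) (b := z) (by rw [dist_comm]; exact hz) hx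
  rw [← dist_eq_norm, dist_comm]
  exact le_of_lt this

/-- The error `X s b - X s a - Φ s (b - a)` starts at zero and grows at rate at most `K` times
itself plus a linearization error `o(|b - a|)`; Grönwall's inequality keeps it `o(|b - a|)`. -/
theorem IsSolutionMap.hasFDerivAt {f : (Fin n → ℝ) → Fin n → ℝ} {K : ℝ≥0}
    (hf : ContDiff ℝ 1 f) (hfK : LipschitzWith K f) {X : ℝ → (Fin n → ℝ) → Fin n → ℝ}
    (hX : IsSolutionMap f X) (a : Fin n → ℝ) {T : ℝ}
    {Φ : ℝ → (Fin n → ℝ) →L[ℝ] Fin n → ℝ} (hΦ0 : ∀ h, Φ 0 h = h)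
    (hΦ : ∀ t ∈ Icc 0 T, ∀ h,
      HasDerivWithinAt (fun s => Φ s h) (fderiv ℝ f (X t a) (Φ t h)) (Icc 0 T) t)
    {t : ℝ} (ht : t ∈ Icc 0 T) : HasFDerivAt (X t) (Φ t) a := by
  have hT : 0 ≤ T := ht.1.trans ht.2
  set E := Real.exp (K * T) with hE
  have hEpos : 0 < E := Real.exp_pos _
  set G := gronwallBound 0 K 1 T with hG
  have hGmono : Monotone (gronwallBound 0 K 1) := gronwallBound_mono le_rfl zero_le_one K.2
  have hG0 : 0 ≤ G := by
    have := hGmono hT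
    rwa [gronwallBound_x0] at this
  have hS : IsCompact ((fun s => X s a) '' Icc 0 T) :=
    isCompact_Icc.image_of_continuousOn ((hX.continuousOn a).mono Icc_subset_Ici_self)
  rw [hasFDerivAt_iff_isLittleO, Asymptotics.isLittleO_iff]
  intro c hc
  -- `E` bounds the spreading of trajectories and `G` the Grönwall factor; `G + 1` avoids division
  -- by zero when `T = 0`.
  set ε := c / (E * (G + 1)) with hεdef
  have hε : 0 < ε := by positivity
  obtain ⟨δ, hδ, hlin⟩ := exists_uniform_linearization hf hS hε
  filter_upwards [Metric.ball_mem_nhds a (div_pos hδ hEpos)] with b hb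
  have hdist : ∀ s ∈ Icc 0 T, dist (X s b) (X s a) ≤ dist b a * E := by
    intro s hs
    have h1 := dist_le_of_trajectories_ODE (v := fun _ => f) (K := K) (fun _ => hfK)
      (f := fun s => X s b) (g := fun s => X s a) (a := 0) (b := T) (δ := dist b a)
      ((hX.continuousOn b).mono Icc_subset_Ici_self)
      (fun s hs => hX.hasDerivWithinAt_Ici b hs.1)
      ((hX.continuousOn a).mono Icc_subset_Ici_self)
      (fun s hs => hX.hasDerivWithinAt_Ici a hs.1)
      (by rw [(hX a).1, (hX b).1]) s hs
    refine h1.trans ?_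
    rw [sub_zero, hE]
    have := hs.2
    gcongr
  have hgr := norm_le_gronwallBound_of_norm_deriv_right_le
    (f := fun s => X s b - X s a - Φ s (b - a))
    (f' := fun s => f (X s b) - f (X s a) - fderiv ℝ f (X s a) (Φ s (b - a)))
    (δ := 0) (K := K) (ε := ε * (dist b a * E)) (a := 0) (b := T)
    (((hX.continuousOn b).mono Icc_subset_Ici_self).sub
      ((hX.continuousOn a).mono Icc_subset_Ici_self) |>.sub
        fun s hs => (hΦ s hs _).continuousWithinAt)
    (fun s hs => ((hX.hasDerivWithinAt_Ici b hs.1).sub (hX.hasDerivWithinAt_Ici a hs.1)).sub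
      ((hΦ s (Ico_subset_Icc_self hs) _).mono_of_mem_nhdsWithin (Icc_mem_nhdsGE_of_mem hs)))
    (by simp [(hX a).1, (hX b).1, hΦ0])
    (fun s hs => by
      have hs' := Ico_subset_Icc_self hs
      have h1 := hlin (X s a) ⟨s, hs', rfl⟩ (X s b)
        ((hdist s hs').trans_lt ((lt_div_iff₀ hEpos).1 hb))
      have h2 : f (X s b) - f (X s a) - fderiv ℝ f (X s a) (Φ s (b - a)) =
          fderiv ℝ f (X s a) (X s b - X s a - Φ s (b - a)) +
          (f (X s b) - f (X s a) - fderiv ℝ f (X s a) (X s b - X s a)) := by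
        rw [map_sub (fderiv ℝ f (X s a)) (X s b - X s a)]; abel
      rw [h2]
      refine (norm_add_le _ _).trans (add_le_add ?_ (h1.trans ?_))
      · refine (ContinuousLinearMap.le_opNorm _ _).trans ?_
        have := norm_fderiv_le_of_lipschitz ℝ hfK (x₀ := X s a)
        gcongr
      · rw [← dist_eq_norm]
        have := hdist s hs'
        gcongr) t ht
  refine hgr.trans ?_
  rw [sub_zero, gronwallBound_zero_eq_mul, ← dist_eq_norm]
  have h3 : gronwallBound 0 K 1 t ≤ G + 1 := (hGmono ht.2).trans (by linarith)
  calc ε * (dist b a * E) * gronwallBound 0 K 1 t ≤ ε * (dist b a * E) * (G + 1) := by gcongr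
    _ = c * dist b a := by rw [hεdef]; field_simp

end Flow

end KContraction

namespace KContraction

/-! ### From row bounds to contraction of the flow -/

section Contraction

variable {n k : ℕ}

theorem jacobian_mulVec (f : (Fin n → ℝ) → Fin n → ℝ) (x v : Fin n → ℝ) :
    (jacobian f x).mulVec v = fderiv ℝ f x v :=
  LinearMap.toMatrix'_mulVec _ _

theorem nonempty_Q (h : k ≤ n) : Nonempty (Q k n) := ⟨Fin.castLEOrderEmb h⟩

/-- The infinitesimal condition, expressed by rows, implies `k`-contraction for `C¹` globally
Lipschitz vector fields. -/
theorem isKContractive_of_rowLogNorm_le {f : (Fin n → ℝ) → Fin n → ℝ} {K : NNReal}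
    (hf : ContDiff ℝ 1 f) (hfK : LipschitzWith K f) (hkn : k ≤ n) {T : Q k n → ℝ}
    (hT : ∀ α, 0 < T α) {η : ℝ}
    (hrow : ∀ x α, rowLogNorm T (addCompound k (jacobian f x)) α ≤ -η) :
    IsKContractive k f η (scaledSupNorm (Matrix.diagonal T)) := by
  have := nonempty_Q hkn
  obtain ⟨X, hX⟩ := exists_isSolutionMap hfK
  refine ⟨X, hX, fun t ht a => ?_⟩
  have hXc : ContinuousOn (fun s => X s a) (Set.Icc 0 t) :=
    (hX.continuousOn a).mono Set.Icc_subset_Ici_self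
  obtain ⟨Φ, hΦ0, hΦ⟩ := exists_fundamental_solution (A := fun s => fderiv ℝ f (X s a)) ht
    ((hf.continuous_fderiv one_ne_zero).comp_continuousOn hXc)
  have hder := hX.hasFDerivAt hf hfK a hΦ0 hΦ ⟨ht, le_rfl⟩
  refine ⟨hder.differentiableAt, fun v => ?_⟩
  rw [hder.fderiv]
  have hw : ∀ s ∈ Set.Icc 0 t, HasDerivWithinAt (fun τ => wedge fun j => Φ τ (v j))
      ((addCompound k (jacobian f (X s a))).mulVec (wedge fun j => Φ s (v j)))
      (Set.Icc 0 t) s := fun s hs =>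
    hasDerivWithinAt_wedge (v := fun τ j => Φ τ (v j)) fun j => by
      rw [jacobian_mulVec]; exact hΦ s hs (v j)
  have key := scaledSupNorm_le_exp_mul hT (A := fun s => addCompound k (jacobian f (X s a)))
    (y := fun τ => wedge fun j => Φ τ (v j)) ht (fun s hs => (hw s hs).continuousWithinAt)
    (fun s hs => (hw s (Set.Ico_subset_Icc_self hs)).mono_of_mem_nhdsWithin
      (Icc_mem_nhdsGE_of_mem hs))
    (fun s _ => hrow (X s a))
  simpa only [hΦ0] using key

end Contraction

/-! ### The Hopfield field and its dominance condition -/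

section Hopfield

variable {n k : ℕ}

theorem contDiff_hopfield (r : Fin n → ℝ) (W : Matrix (Fin n) (Fin n) ℝ) {φ : Fin n → ℝ → ℝ}
    (hφ : ∀ i, ContDiff ℝ 1 (φ i)) (u : Fin n → ℝ) : ContDiff ℝ 1 (hopfield r W φ u) := by
  refine contDiff_pi.2 fun i => ?_
  unfold hopfield
  refine ((((contDiff_apply ℝ ℝ i).div_const _).neg).add (ContDiff.sum fun j _ => ?_)).add
    contDiff_const
  exact contDiff_const.mul ((hφ j).comp (contDiff_apply ℝ ℝ j))

theorem jacobian_hopfield (r : Fin n → ℝ) (W : Matrix (Fin n) (Fin n) ℝ) {φ : Fin n → ℝ → ℝ}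
    (hφ : ∀ i, ContDiff ℝ 1 (φ i)) (u x : Fin n → ℝ) (i p : Fin n) :
    jacobian (hopfield r W φ u) x i p =
      (if i = p then -(r i)⁻¹ else 0) + W i p * deriv (φ p) (x p) := by
  let e : Fin n → ℝ := Pi.single p 1
  have hd : DifferentiableAt ℝ (hopfield r W φ u) x :=
    ((contDiff_hopfield r W hφ u).differentiable one_ne_zero).differentiableAt
  have h1 : HasDerivAt (fun τ : ℝ => hopfield r W φ u (x + τ • e) i)
      (jacobian (hopfield r W φ u) x i p) 0 := by
    have hl : HasDerivAt (fun τ : ℝ => x + τ • e) e 0 := by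
      have h := ((hasDerivAt_id (0 : ℝ)).smul_const e).const_add x
      rwa [one_smul] at h
    have hd' : HasFDerivAt (hopfield r W φ u) (fderiv ℝ (hopfield r W φ u) x)
        (x + (0 : ℝ) • e) := by
      rw [zero_smul, add_zero]; exact hd.hasFDerivAt
    have h := hasDerivAt_pi.1 (hd'.comp_hasDerivAt (0 : ℝ) hl) i
    have he : jacobian (hopfield r W φ u) x i p = fderiv ℝ (hopfield r W φ u) x e i := by
      rw [← jacobian_mulVec]
      simp [e]
    rw [he]
    exact h
  have hc : ∀ j, HasDerivAt (fun τ : ℝ => x j + τ * e j) (e j) 0 := fun j => by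
    have h := ((hasDerivAt_id (0 : ℝ)).mul_const (e j)).const_add (x j)
    rwa [one_mul] at h
  have h2 : HasDerivAt (fun τ : ℝ => hopfield r W φ u (x + τ • e) i)
      (-(e i / r i) + ∑ j, W i j * (deriv (φ j) (x j) * e j)) 0 := by
    refine (((hc i).div_const _).neg.add (HasDerivAt.fun_sum fun j _ => ?_)).add_const _
    refine HasDerivAt.const_mul _ ?_
    have hφj : HasDerivAt (φ j) (deriv (φ j) (x j)) (x j + 0 * e j) := by
      rw [zero_mul, add_zero]
      exact ((hφ j).differentiable one_ne_zero).differentiableAt.hasDerivAt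
    exact hφj.comp (0 : ℝ) (hc j)
  rw [h1.unique h2]
  congr 1
  · by_cases h : i = p
    · subst h; simp [e]
    · simp [e, h]
  · rw [Finset.sum_eq_single p] <;> simp +contextual [e]

theorem exists_lipschitzWith_hopfield (r : Fin n → ℝ) (W : Matrix (Fin n) (Fin n) ℝ)
    {φ : Fin n → ℝ → ℝ} (hφ : ∀ i, ContDiff ℝ 1 (φ i)) {M : Fin n → ℝ}
    (hM : ∀ i z, |deriv (φ i) z| ≤ M i) (u : Fin n → ℝ) :
    ∃ K, LipschitzWith K (hopfield r W φ u) := by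
  have hM0 : ∀ i, 0 ≤ M i := fun i => (abs_nonneg _).trans (hM i 0)
  have hlip : ∀ j a b, |φ j a - φ j b| ≤ M j * |a - b| := fun j a b =>
    convex_univ.norm_image_sub_le_of_norm_deriv_le (f := φ j) (C := M j)
      (fun z _ => ((hφ j).differentiable one_ne_zero).differentiableAt) (fun z _ => hM j z)
      (Set.mem_univ b) (Set.mem_univ a)
  set κ : Fin n → ℝ := fun i => |(r i)⁻¹| + ∑ j, |W i j| * M j with hκ
  have hκ0 : ∀ i, 0 ≤ κ i := fun i => add_nonneg (abs_nonneg _)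
    (Finset.sum_nonneg fun j _ => mul_nonneg (abs_nonneg _) (hM0 j))
  have hK : 0 ≤ ∑ i, κ i := Finset.sum_nonneg fun i _ => hκ0 i
  refine ⟨⟨∑ i, κ i, hK⟩, LipschitzWith.of_dist_le_mul fun x y => ?_⟩
  refine (dist_pi_le_iff (mul_nonneg hK dist_nonneg)).2 fun i => ?_
  have hxy : ∀ j, |x j - y j| ≤ dist x y := fun j => dist_le_pi_dist x y j
  have hle : κ i ≤ ∑ i, κ i := Finset.single_le_sum (fun i _ => hκ0 i) (Finset.mem_univ i)
  refine le_trans ?_ (mul_le_mul_of_nonneg_right hle dist_nonneg)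
  have hdiff : hopfield r W φ u x i - hopfield r W φ u y i =
      -((r i)⁻¹ * (x i - y i)) + ∑ j, W i j * (φ j (x j) - φ j (y j)) := by
    simp only [hopfield, mul_sub, Finset.sum_sub_distrib, div_eq_inv_mul]
    ring
  rw [Real.dist_eq, hdiff, hκ, add_mul, Finset.sum_mul]
  refine (abs_add_le _ _).trans (add_le_add ?_ ?_)
  · rw [abs_neg, abs_mul]
    exact mul_le_mul_of_nonneg_left (hxy i) (abs_nonneg _)
  · refine (Finset.abs_sum_le_sum_abs _ _).trans (Finset.sum_le_sum fun j _ => ?_)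
    rw [abs_mul, mul_assoc]
    refine mul_le_mul_of_nonneg_left ((hlip j _ _).trans ?_) (abs_nonneg _)
    exact mul_le_mul_of_nonneg_left (hxy j) (hM0 j)

theorem sum_eq_sum_add_sum_compl (α : Q k n) (g : Fin n → ℝ) :
    ∑ j, g j = ∑ i, g (α i) + ∑ p ∈ Finset.univ.filter (fun p => ∀ j, α j ≠ p), g p := by
  rw [← Finset.sum_filter_not_add_sum_filter Finset.univ (fun p => ∀ j, α j ≠ p)]
  congr 1
  rw [← Finset.sum_image (s := Finset.univ) (g := α) (f := g) fun a _ b _ h => α.injective h]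
  refine Finset.sum_congr ?_ fun _ _ => rfl
  ext p
  simp

theorem card_compl (α : Q k n) :
    ((Finset.univ.filter (fun p => ∀ j, α j ≠ p)).card : ℝ) = (n : ℝ) - k := by
  have h := sum_eq_sum_add_sum_compl α fun _ => 1
  simp only [Finset.sum_const, Finset.card_univ, Fintype.card_fin, nsmul_eq_mul, mul_one] at h
  linarith

/-- Summing the dominance conditions over the indices outside of `α` bounds the row `α`. -/
theorem row_bound_of_column_bounds (hkn : k < n) {J w : Matrix (Fin n) (Fin n) ℝ}
    {c l : Fin n → ℝ} {d : Fin n → ℝ} (hd : ∀ i, 0 < d i) {η : ℝ}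
    (hdiag : ∀ i, J i i ≤ c i) (hoff : ∀ i p, i ≠ p → |J i p| ≤ w i p)
    (hw : ∀ i p, 0 ≤ w i p) (hl : ∀ i, l i ≤ c i)
    (hdom : ∀ i, -((n : ℝ) - k - 1) * l i
      + ∑ j ∈ Finset.univ.erase i, (c j + ((n : ℝ) - k) * (d j / d i) * w j i) ≤ -η) (α : Q k n) :
    ∑ i, (J (α i) (α i) +
        ∑ p ∈ Finset.univ.filter (fun p => ∀ j, α j ≠ p), |J (α i) p| * (d (α i) / d p)) ≤ -η := by
  set P := Finset.univ.filter (fun p => ∀ j, α j ≠ p) with hP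
  set N : ℝ := (n : ℝ) - k with hN
  have hN1 : 1 ≤ N := by
    have : (k : ℝ) + 1 ≤ n := by exact_mod_cast hkn
    linarith
  have hcard : (P.card : ℝ) = N := card_compl α
  -- The hypothesis at `p`, with `l p` raised to `c p` and the nonnegative terms with `j ∉ α`
  -- dropped.
  have hp : ∀ p ∈ P, (∑ j, c j) - N * c p + N * ∑ i, d (α i) / d p * w (α i) p ≤ -η := by
    intro p hpP
    refine le_trans ?_ (hdom p)
    rw [Finset.sum_add_distrib]
    have h1 : ∑ j ∈ Finset.univ.erase p, c j = (∑ j, c j) - c p := by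
      rw [← Finset.add_sum_erase _ _ (Finset.mem_univ p)]; ring
    have h2 : N * ∑ i, d (α i) / d p * w (α i) p ≤
        ∑ j ∈ Finset.univ.erase p, N * (d j / d p) * w j p := by
      have hi : ∑ i, d (α i) / d p * w (α i) p =
          ∑ j ∈ Finset.univ.image α, d j / d p * w j p :=
        (Finset.sum_image (f := fun j => d j / d p * w j p)
            fun a _ b _ h => α.injective h).symm
      rw [hi, Finset.mul_sum]
      simp only [mul_assoc]
      refine Finset.sum_le_sum_of_subset_of_nonneg ?_ fun j _ _ => ?_
      · intro j hj
        obtain ⟨i, -, rfl⟩ := Finset.mem_image.1 hj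
        exact Finset.mem_erase.2 ⟨(Finset.mem_filter.1 hpP).2 i, Finset.mem_univ _⟩
      · have := hd j; have := hd p; have := hw j p
        positivity
    have h3 : (N - 1) * l p ≤ (N - 1) * c p :=
      mul_le_mul_of_nonneg_left (hl p) (by linarith)
    rw [h1]
    linarith
  have hsum := Finset.sum_le_sum hp
  rw [Finset.sum_add_distrib, Finset.sum_sub_distrib, Finset.sum_const, Finset.sum_const,
    nsmul_eq_mul, nsmul_eq_mul, hcard, ← Finset.mul_sum, ← Finset.mul_sum,
    sum_eq_sum_add_sum_compl α c, ← hP, Finset.sum_comm] at hsum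
  -- After summation over `P` the terms `N * c p` cancel, and the common factor `N ≥ 1` divides out.
  have hfin : ∑ i, c (α i) + ∑ i, ∑ p ∈ P, d (α i) / d p * w (α i) p ≤ -η := by
    refine le_of_mul_le_mul_left ?_ (show 0 < N by linarith)
    linarith
  refine le_trans ?_ hfin
  rw [Finset.sum_add_distrib]
  refine add_le_add (Finset.sum_le_sum fun i _ => hdiag _)
    (Finset.sum_le_sum fun i _ => Finset.sum_le_sum fun p hpP => ?_)
  rw [mul_comm]
  have h1 := hoff (α i) p ((Finset.mem_filter.1 hpP).2 i)
  have := hd (α i); have := hd p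
  gcongr

end Hopfield

end KContraction

theorem mainTheorem5 (n k : ℕ) (hk : 1 ≤ k) (hkn : k < n)
    (r : Fin n → ℝ) (hr : ∀ i, 0 < r i)
    (W : Matrix (Fin n) (Fin n) ℝ) (u : Fin n → ℝ)
    (φ : Fin n → ℝ → ℝ) (hφ : ∀ i, ContDiff ℝ 1 (φ i))
    (m M : Fin n → ℝ) (hm : ∀ i, 0 ≤ m i)
    (hmM : ∀ i z, m i ≤ |deriv (φ i) z| ∧ |deriv (φ i) z| ≤ M i)
    (η : ℝ) (hη : 0 < η)
    (d : Fin n → ℝ) (hd : ∀ i, 0 < d i)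
    (hdom : ∀ i, -((n : ℝ) - k - 1) * (-(r i)⁻¹ - m i * |W i i|)
      + ∑ j ∈ Finset.univ.erase i,
          (-(r j)⁻¹ + M j * |W j j| + ((n : ℝ) - k) * (d j / d i) * M i * |W j i|) ≤ -η) :
    KContraction.InfinitesimallyKContractive k (KContraction.hopfield r W φ u) η
        (KContraction.scaledSupNorm (KContraction.mulCompound k (Matrix.diagonal d))) ∧
      KContraction.IsKContractive k (KContraction.hopfield r W φ u) η
        (KContraction.scaledSupNorm (KContraction.mulCompound k (Matrix.diagonal d))) := by
  rw [KContraction.mulCompound_diagonal]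
  have hT : ∀ α : KContraction.Q k n, 0 < ∏ i, d (α i) := fun α =>
    Finset.prod_pos fun i _ => hd _
  have hM0 : ∀ i, 0 ≤ M i := fun i => (abs_nonneg _).trans (hmM i 0).2
  have habs : ∀ i p (x : Fin n → ℝ), |W i p * deriv (φ p) (x p)| ≤ M p * |W i p| := by
    intro i p x
    rw [abs_mul, mul_comm]
    exact mul_le_mul_of_nonneg_right (hmM p _).2 (abs_nonneg _)
  have hrow : ∀ x (α : KContraction.Q k n), KContraction.rowLogNorm (fun α => ∏ i, d (α i))
      (KContraction.addCompound k (KContraction.jacobian (KContraction.hopfield r W φ u) x)) α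
        ≤ -η := by
    intro x α
    refine (KContraction.scaled_addCompound_row_le _ hd α).trans ?_
    refine KContraction.row_bound_of_column_bounds hkn (w := fun i p => M p * |W i p|)
      (c := fun i => -(r i)⁻¹ + M i * |W i i|) (l := fun i => -(r i)⁻¹ - m i * |W i i|)
      hd (fun i => ?_) (fun i p hip => ?_)
      (fun i p => mul_nonneg (hM0 p) (abs_nonneg _)) (fun i => ?_) (fun i => ?_) α
    · rw [KContraction.jacobian_hopfield r W hφ, if_pos rfl]
      have := (le_abs_self _).trans (habs i i x)
      linarith
    · rw [KContraction.jacobian_hopfield r W hφ, if_neg hip, zero_add]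
      exact habs i p x
    · have h1 := mul_nonneg (hm i) (abs_nonneg (W i i))
      have h2 := mul_nonneg (hM0 i) (abs_nonneg (W i i))
      linarith
    · simpa only [mul_assoc] using hdom i
  have := KContraction.nonempty_Q hkn.le
  obtain ⟨K, hK⟩ := KContraction.exists_lipschitzWith_hopfield r W hφ (fun i z => (hmM i z).2) u
  exact ⟨fun x => KContraction.exists_hasLogNorm_scaledSupNorm_le hT _ (hrow x),
    KContraction.isKContractive_of_rowLogNorm_le (KContraction.contDiff_hopfield r W hφ u) hK
      hkn.le hT hrow⟩
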